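/- Let $(W,S)$ be a finite Coxeter system and $p$ a prime. For $J\subseteq S$ let $W_J=\langle J\rangle$, let $X_J$ be the set of elements of $W$ of minimal length in their left coset $wW_J$, and let $x_J=\sum_{w\in X_J}w\in\mathbb{Q}W$. Let $\Sigma_W$ be the descent algebra of $W$, i.e. the $\mathbb{Q}$-subalgebra of $\mathbb{Q}W$ generated by (equivalently, by Solomon's theorem, spanned by) the $x_J$, $J\subseteq S$; let $\mathcal{Z}_W$ be the subring generated by (equivalently, the $\mathbb{Z}$-span of) the $x_J$; let $\Sigma(W,p)=\mathcal{Z}_W/p\mathcal{Z}_W$, and let $\overline{x}_J$ be the image of $x_J$ in $\Sigma(W,p)$. Let $E$ be a set of representatives of the $W$-conjugacy classes of subsets of $S$ and let $$M^c(W)=(\beta_{JK})_{J,K\in E},\qquad \beta_{JK}=|\mathrm{Fix}_{W/W_J}(W_K)|,$$ be the parabolic table of marks. Let $s$ be the number of $J\in E$ such that $p$ does not divide $[N_W(W_J):W_J]$. 1. The columns of $M^c(W)$ define the irreducible representations of $\Sigma_W$: for each $K\in E$ there is a ring homomorphism $\lambda_K:\Sigma_W\to\mathbb{Q}$ with $\lambda_K(x_{J'})=\beta_{JK}$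 whenever $J\in E$ and $J'\subseteq S$ is conjugate to $J$; the $\lambda_K$ ($K\in E$) are pairwise distinct; and, for every field $k$ of characteristic $0$, a representation of $\Sigma_W$ on a $k$-vector space is irreducible if and only if it is one-dimensional and given by $\lambda_K$ for some $K\in E$. 2. The columns of $M^c(W)$ modulo $p$ define the irreducible representations of $\Sigma(W,p)$: for each $K\in E$ there is a ring homomorphism $\mu_K:\Sigma(W,p)\to\mathbb{F}_p$ with $\mu_K(\overline{x}_{J'})=\beta_{JK}\bmod p$ whenever $J\in E$ and $J'\subseteq S$ is conjugate to $J$; $\mu_K=\mu_L$ if and only if the columns $K$ and $L$ of $M^c(W)$ are equal modulo $p$; and, for every field $k$ of characteristic $p$, a representation of $\Sigma(W,p)$ on a $k$-vector space is irreducible if and only if it is one-dimensional and given by $\mu_K$ for some $K\in E$. Moreover, $M^c(W)$ modulo $p$ has precisely $s$ distinct columns. -/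

import Mathlib

noncomputable section

namespace Descent

variable {B W : Type*} [Group W] {M : CoxeterMatrix B} (cs : CoxeterSystem M W)

/-! Subsets of the set `S` of fundamental reflections are given as subsets `J : Set B` of the
index set of the Coxeter system. -/

/-- The standard parabolic subgroup `W_J`, generated by the reflections in `J`. -/
def parabolic (J : Set B) : Subgroup W :=
  Subgroup.closure (cs.simple '' J)

/-- `X_J`: the elements of `W` that have minimal length in their left coset `w W_J`. -/
def minReps (J : Set B) : Set W :=
  {w | ∀ v ∈ parabolic cs J, cs.length w ≤ cs.length (w * v)}

/-- Two subsets `J`, `K` of `S` are conjugate: `w J w⁻¹ = K` for some `w` in `W`. -/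
def Conj (J K : Set B) : Prop :=
  ∃ w : W, (fun x => w * x * w⁻¹) '' (cs.simple '' J) = cs.simple '' K

/-- `E` contains exactly one subset of `S` from every conjugacy class of subsets of `S`. -/
def IsRepresentatives (E : Set (Set B)) : Prop :=
  ∀ J : Set B, ∃! K : Set B, K ∈ E ∧ Conj cs J K

/-- The mark `β_{JK}`: the number of fixed points of `W_K` on the coset space `W / W_J`. -/
def mark (J K : Set B) : ℕ :=
  Nat.card (MulAction.fixedPoints (parabolic cs K) (W ⧸ parabolic cs J))

/-- The parabolic table of marks `M^c(W)`, with rows and columns indexed by `E`. -/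
def tableOfMarks (E : Set (Set B)) : Matrix E E ℤ :=
  Matrix.of fun J K => (mark cs J K : ℤ)

/-- The table of marks with its entries reduced modulo `p`. -/
def tableOfMarksMod (E : Set (Set B)) (p : ℕ) : Matrix E E (ZMod p) :=
  (tableOfMarks cs E).map (Int.cast : ℤ → ZMod p)

/-- The index `[N_W(W_J) : W_J]`. -/
def normalizerIndex (J : Set B) : ℕ :=
  (parabolic cs J).relIndex (Subgroup.normalizer (parabolic cs J : Set W))

section Algebra

variable [Finite W]

/-- `x_J`, the sum of the elements of `X_J` in the rational group algebra. -/
def xElt (J : Set B) : MonoidAlgebra ℚ W :=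
  ∑ w ∈ (Set.toFinite (minReps cs J)).toFinset, MonoidAlgebra.of ℚ W w

/-- The descent algebra `Σ_W`, the subalgebra of the rational group algebra generated by the `x_J`.
(By Solomon's theorem it is the linear span of the `x_J`.) -/
def descentAlgebra : Subalgebra ℚ (MonoidAlgebra ℚ W) :=
  Algebra.adjoin ℚ (Set.range (xElt cs))

/-- The integral form `𝒵_W`, the subring of `Σ_W` generated by the `x_J`.
(By Solomon's theorem it is the `ℤ`-span of the `x_J`.) -/
def integralForm : Subring (MonoidAlgebra ℚ W) :=
  Subring.closure (Set.range (xElt cs))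

/-- The ideal `p 𝒵_W` of `𝒵_W`. -/
def pIdeal (p : ℕ) : Ideal (integralForm cs) :=
  Ideal.span {(p : integralForm cs)}

instance pIdeal_isTwoSided (p : ℕ) : (pIdeal cs p).IsTwoSided := by
  refine ⟨fun {a} b ha => ?_⟩
  obtain ⟨c, rfl⟩ := Ideal.mem_span_singleton'.1 ha
  refine Ideal.mem_span_singleton'.2 ⟨c * b, ?_⟩
  rw [mul_assoc, mul_assoc, (Nat.cast_commute p b).eq]

/-- The `p`-modular descent algebra `Σ(W, p) = 𝒵_W / p 𝒵_W`. -/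
abbrev DescentAlgebraMod (p : ℕ) : Type _ :=
  integralForm cs ⧸ pIdeal cs p

/-- `x_J` as an element of `Σ_W`. -/
def xDescent (J : Set B) : descentAlgebra cs :=
  ⟨xElt cs J, Algebra.subset_adjoin (Set.mem_range_self J)⟩

/-- `x_J` as an element of `𝒵_W`. -/
def xIntegral (J : Set B) : integralForm cs :=
  ⟨xElt cs J, Subring.subset_closure (Set.mem_range_self J)⟩

/-- The image of `x_J` in `Σ(W, p)`. -/
def xMod (p : ℕ) (J : Set B) : DescentAlgebraMod cs p :=
  Ideal.Quotient.mk (pIdeal cs p) (xIntegral cs J)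

end Algebra

end Descent

/-- A representation `ρ` of a ring `A` on a vector space `V` over a field `k` is irreducible if
`V ≠ 0` and the only `A`-invariant `k`-subspaces of `V` are `0` and `V`. (If `A` is an algebra over
the prime field of `k`, a ring homomorphism `A → End_k V` is automatically an algebra
homomorphism.) -/
def IsIrreducibleRep {A k V : Type*} [Ring A] [Field k] [AddCommGroup V] [Module k V]
    (ρ : A →+* Module.End k V) : Prop :=
  Nontrivial V ∧
    ∀ U : Submodule k V, (∀ a : A, ∀ u ∈ U, ρ a u ∈ U) → U = ⊥ ∨ U = ⊤

/-- `ρ` is the one-dimensional representation over `k` given by the character `f : A → F`, with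
values in a field `F` contained in `k`. -/
def IsGivenByCharacter {A F k V : Type*} [Ring A] [Field F] [Field k] [Algebra F k]
    [AddCommGroup V] [Module k V] (ρ : A →+* Module.End k V) (f : A →+* F) : Prop :=
  Module.finrank k V = 1 ∧ ∀ (a : A) (v : V), ρ a v = algebraMap F k (f a) • v

end

/-! ### Inversion parity and the exchange condition. -/

noncomputable section

namespace Descent

variable {B W : Type*} [Group W] {M : CoxeterMatrix B} (cs : CoxeterSystem M W)

/-! Solomon's formula (`repSum_mul_repSum`) expands x_J x_K as the sum of x_I, I = {s ∈ K : d s d⁻¹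
∈ W_J}, over the elements d minimal in both W_J d and d W_K. Each I lies in K, so left
multiplication by x_J is triangular for inclusion. Moreover I = K exactly when W_K fixes the coset
d⁻¹W_J, so the diagonal coefficient is β_{JK} (`card_fixedPoints_eq`).

Since the x_K are linearly independent, the diagonal coefficients define characters
(`exists_character`). They are integral on 𝒵_W and hence reduce modulo p. Conversely, in an
irreducible representation choose K minimal with x_K acting nontrivially: the algebra acts on the
image of x_K through the K-th character, so any nonzero vector of that image spans the whole space
(`IsIrreducibleRep.exists_isGivenByCharacter`).

Distinctness holds because β_{KK} = [N_W(W_K) : W_K] is nonzero, while β_{JK} ≠ 0 forces K to be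
conjugate into J. Modulo p this still separates the columns with p ∤ β_{KK}. If p ∣ β_{KK}, an
element n of order p modulo W_K normalizes W_K, and W_K and ⟨W_K, n⟩ have congruent fixed point
counts. Passing from ⟨W_K, n⟩ to its parabolic closure gives an equal column modulo p for a larger
parabolic subgroup, and iteration ends at a column with p ∤ β_{LL} (`exists_not_dvd`).

The combinatorics rests on `invParity`, a cocycle on W that detects descents. Subsets of S are
mostly handled as sets of elements of W, since the sets I arise in that form. -/

open scoped Classical in
/-- The action of a simple reflection on pairs consisting of a group element and a sign. -/
def signAct (i : B) : Function.End (W × ZMod 2) := fun x =>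
  (cs.simple i * x.1 * cs.simple i, x.2 + if x.1 = cs.simple i then 1 else 0)

-- Listing the elements at which the sign flips turns the braid relation into a count modulo two.
open scoped Classical in
theorem signAct_mul_pow (i j : B) (k : ℕ) (t : W) (ε : ZMod 2) :
    ((signAct cs i * signAct cs j) ^ k) (t, ε) =
      ((cs.simple i * cs.simple j) ^ k * t * ((cs.simple i * cs.simple j) ^ k)⁻¹,
        ε + ∑ l ∈ Finset.range (2 * k),
          if t = cs.simple j * (cs.simple i * cs.simple j) ^ l then 1 else 0) := by
  induction k with
  | zero => simp [Function.End.one_def]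
  | succ k ih =>
    rw [pow_succ']
    change (signAct cs i (signAct cs j (((signAct cs i * signAct cs j) ^ k) (t, ε)))) = _
    rw [ih]
    set r := cs.simple i * cs.simple j with hr
    have hj : cs.simple j * r * cs.simple j = r⁻¹ := by simp [hr, mul_assoc]
    have hjk : ∀ k : ℕ, (r ^ k)⁻¹ * cs.simple j = cs.simple j * r ^ k := by
      intro k
      have h1 : cs.simple j * r ^ k * (cs.simple j)⁻¹ = (r ^ k)⁻¹ := by
        rw [← conj_pow, cs.inv_simple, hj, inv_pow]
      rw [← h1]; simp
    have e1 : r ^ k * t * (r ^ k)⁻¹ = cs.simple j ↔ t = cs.simple j * r ^ (2 * k) := by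
      rw [two_mul, pow_add, ← mul_assoc, ← hjk k]
      constructor
      · intro h; rw [← h]; group
      · intro h; rw [h]; group
    have e2 : cs.simple j * (r ^ k * t * (r ^ k)⁻¹) * cs.simple j = cs.simple i ↔
        t = cs.simple j * r ^ (2 * k + 1) := by
      have : cs.simple j * r ^ (2 * k + 1) =
          (r ^ k)⁻¹ * (cs.simple j * cs.simple i * cs.simple j) * r ^ k := by
        rw [show 2 * k + 1 = k + 1 + k by ring, pow_add, pow_succ, ← mul_assoc, ← mul_assoc,
          ← hjk k, hr]
        simp only [mul_assoc]
      rw [this]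
      constructor
      · intro h; rw [← h]; simp [mul_assoc]
      · intro h; rw [h]; simp [mul_assoc]
    simp only [signAct, e1, e2]
    rw [show 2 * (k + 1) = 2 * k + 1 + 1 by ring, Finset.sum_range_succ, Finset.sum_range_succ]
    refine Prod.ext ?_ ?_
    · simp [pow_succ', hr, mul_assoc]
    · simp [add_assoc]

/-- For k = m(i,j) the sum has 2m terms, and its two halves agree because (s_i s_j)^m = 1; hence it
vanishes modulo two. -/
theorem isLiftable_signAct : M.IsLiftable (signAct cs) := by
  classical
  intro i j
  funext ⟨t, ε⟩
  rw [signAct_mul_pow, two_mul, Finset.sum_range_add]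
  simp only [pow_add, cs.simple_mul_simple_pow, one_mul, ← two_mul]
  rw [show (2 : ZMod 2) = 0 from rfl]
  simp [Function.End.one_def]

/-- The number of inversions of `w` equal to `t` in any word for `w`, modulo two. -/
def invParity (w t : W) : ZMod 2 :=
  (cs.lift ⟨signAct cs, isLiftable_signAct cs⟩ w (t, 0)).2

theorem lift_signAct_apply (w t : W) (ε : ZMod 2) :
    cs.lift ⟨signAct cs, isLiftable_signAct cs⟩ w (t, ε) =
      (w * t * w⁻¹, ε + invParity cs w t) := by
  induction w using cs.simple_induction_left generalizing t ε with
  | one => simp [invParity, Function.End.one_def]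
  | mul_simple_left w i ih =>
    have key : ∀ ε, cs.lift ⟨signAct cs, isLiftable_signAct cs⟩ (cs.simple i * w) (t, ε) =
        signAct cs i (w * t * w⁻¹, ε + invParity cs w t) := by
      intro ε
      rw [map_mul, cs.lift_apply_simple, ← ih]
      rfl
    rw [invParity, key, key]
    simp [signAct, mul_assoc, add_assoc]

/-- The cocycle identity behind all later descent computations. -/
theorem invParity_mul (v w t : W) :
    invParity cs (v * w) t = invParity cs w t + invParity cs v (w * t * w⁻¹) := by
  rw [invParity, map_mul]
  change (cs.lift ⟨signAct cs, isLiftable_signAct cs⟩ v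
    (cs.lift ⟨signAct cs, isLiftable_signAct cs⟩ w (t, 0))).2 = _
  simp [lift_signAct_apply]

open scoped Classical in
theorem invParity_simple (i : B) (t : W) :
    invParity cs (cs.simple i) t = if t = cs.simple i then 1 else 0 := by
  rw [invParity, cs.lift_apply_simple]
  simp [signAct]

theorem invParity_one (t : W) : invParity cs 1 t = 0 := by
  simp [invParity, Function.End.one_def]

theorem zmod_two_ne_one {a : ZMod 2} : a ≠ 1 ↔ a = 0 := by
  revert a; decide

/-- The word need not be reduced, so this yields the exchange condition for arbitrary words. -/
theorem mem_rightInvSeq_of_invParity {ω : List B} {t : W}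
    (h : invParity cs (cs.wordProd ω) t = 1) : t ∈ cs.rightInvSeq ω := by
  induction ω with
  | nil => simp [invParity_one] at h
  | cons i ω ih =>
    rw [cs.wordProd_cons, invParity_mul, invParity_simple] at h
    rw [CoxeterSystem.rightInvSeq, List.mem_cons]
    by_cases h' : invParity cs (cs.wordProd ω) t = 1
    · exact Or.inr (ih h')
    · left
      split_ifs at h with h2
      · rw [← h2]; group
      · rw [add_zero] at h; exact absurd h h'

theorem length_lt_of_invParity {w t : W} (h : invParity cs w t = 1) :
    cs.length (w * t) < cs.length w := by
  obtain ⟨ω, hω, rfl⟩ := cs.exists_isReduced w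
  exact (cs.isRightInversion_of_mem_rightInvSeq hω (mem_rightInvSeq_of_invParity cs h)).2

theorem invParity_mul_simple (w : W) (i : B) :
    invParity cs (w * cs.simple i) (cs.simple i) = 1 + invParity cs w (cs.simple i) := by
  simp [invParity_mul, invParity_simple]

theorem invParity_eq_one_iff {w : W} {i : B} :
    invParity cs w (cs.simple i) = 1 ↔ cs.length (w * cs.simple i) < cs.length w := by
  refine ⟨length_lt_of_invParity cs, fun h => ?_⟩
  by_contra h'
  have h2 : invParity cs (w * cs.simple i) (cs.simple i) = 1 := by
    rw [invParity_mul_simple, (zmod_two_ne_one).1 h', add_zero]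
  have := length_lt_of_invParity cs h2
  rw [cs.simple_mul_simple_cancel_right] at this
  omega

/-! ### Standard parabolic subgroups, indexed by sets of simple reflections -/

theorem mem_closure_of_invParity {K : Set W} (hK : K ⊆ Set.range cs.simple) {u t : W}
    (hu : u ∈ Subgroup.closure K) (h : invParity cs u t = 1) : t ∈ Subgroup.closure K := by
  classical
  induction hu using Subgroup.closure_induction generalizing t with
  | mem x hx =>
    obtain ⟨i, rfl⟩ := hK hx
    rw [invParity_simple] at h
    split_ifs at h with h2
    · rw [h2]; exact Subgroup.subset_closure hx
    · simp at h
  | one => simp [invParity_one] at h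
  | mul x y hx hy ihx ihy =>
    rw [invParity_mul] at h
    by_cases h' : invParity cs y t = 1
    · exact ihy h'
    · rw [zmod_two_ne_one.1 h', zero_add] at h
      have := ihx h
      have h3 := mul_mem (mul_mem (inv_mem hy) this) hy
      simpa [mul_assoc] using h3
  | inv x hx ih =>
    have h1 : invParity cs x⁻¹ t + invParity cs x (x⁻¹ * t * x) = 0 := by
      have := invParity_mul cs x x⁻¹ t
      rw [mul_inv_cancel, invParity_one, inv_inv] at this
      exact this.symm
    have h2 : invParity cs x (x⁻¹ * t * x) = 1 := by
      rw [h] at h1; revert h1; generalize invParity cs x (x⁻¹ * t * x) = a; revert a; decide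
    have h3 := mul_mem (mul_mem hx (ih h2)) (inv_mem hx)
    simpa [mul_assoc] using h3

theorem exists_word_of_mem_closure {K : Set W} (hK : K ⊆ Set.range cs.simple) {u : W}
    (hu : u ∈ Subgroup.closure K) :
    ∃ ω : List B, (∀ i ∈ ω, cs.simple i ∈ K) ∧ cs.wordProd ω = u := by
  induction hu using Subgroup.closure_induction with
  | mem x hx =>
    obtain ⟨i, rfl⟩ := hK hx
    exact ⟨[i], by simpa using hx, by simp⟩
  | one => exact ⟨[], by simp, by simp⟩
  | mul x y _ _ ihx ihy =>
    obtain ⟨ω, h, rfl⟩ := ihx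
    obtain ⟨ω', h', rfl⟩ := ihy
    refine ⟨ω ++ ω', fun i hi => ?_, cs.wordProd_append _ _⟩
    rcases List.mem_append.1 hi with hi | hi
    exacts [h i hi, h' i hi]
  | inv x _ ih =>
    obtain ⟨ω, h, rfl⟩ := ih
    exact ⟨ω.reverse, by simpa using h, cs.wordProd_reverse ω⟩

/-- If the last letter is not a descent, it is an inversion of the prefix. Exchange then cancels it
against a letter of the prefix, leaving a shorter word in K for the same element. -/
theorem exists_invParity_of_word {K : Set W} (ω : List B) (hω : ∀ i ∈ ω, cs.simple i ∈ K)
    (h1 : cs.wordProd ω ≠ 1) : ∃ s ∈ K, invParity cs (cs.wordProd ω) s = 1 := by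
  induction hn : ω.length using Nat.strong_induction_on generalizing ω with
  | _ n ih =>
  rcases List.eq_nil_or_concat ω with rfl | ⟨ω', i, rfl⟩
  · simp at h1
  · by_cases h : invParity cs (cs.wordProd (ω'.concat i)) (cs.simple i) = 1
    · exact ⟨_, hω i (by simp), h⟩
    · rw [cs.wordProd_concat, invParity_mul_simple] at h
      have h2 : invParity cs (cs.wordProd ω') (cs.simple i) = 1 := by
        revert h; generalize invParity cs (cs.wordProd ω') (cs.simple i) = a; revert a; decide
      obtain ⟨j, hj, hj'⟩ := List.mem_iff_getElem.1 (mem_rightInvSeq_of_invParity cs h2)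
      have h3 : cs.wordProd (ω'.concat i) = cs.wordProd (ω'.eraseIdx j) := by
        rw [cs.wordProd_concat, ← hj', ← List.getD_eq_getElem _ 1 hj,
          cs.wordProd_mul_getD_rightInvSeq]
      rw [h3] at h1 ⊢
      refine ih _ ?_ _ (fun k hk => hω k ?_) h1 rfl
      · rw [cs.length_rightInvSeq] at hj
        have := List.length_eraseIdx_add_one hj
        simp at hn
        omega
      · simp [List.mem_of_mem_eraseIdx hk]

theorem exists_invParity_of_ne_one {K : Set W} (hK : K ⊆ Set.range cs.simple) {u : W}
    (hu : u ∈ Subgroup.closure K) (h1 : u ≠ 1) : ∃ s ∈ K, invParity cs u s = 1 := by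
  obtain ⟨ω, hω, rfl⟩ := exists_word_of_mem_closure cs hK hu
  exact exists_invParity_of_word cs ω hω h1

theorem mem_of_simple_mem_closure {K : Set W} (hK : K ⊆ Set.range cs.simple) {i : B}
    (h : cs.simple i ∈ Subgroup.closure K) : cs.simple i ∈ K := by
  classical
  have h1 : cs.simple i ≠ 1 := by
    intro h; have := cs.length_simple i; rw [h, cs.length_one] at this; omega
  obtain ⟨s, hs, h2⟩ := exists_invParity_of_ne_one cs hK h h1
  rw [invParity_simple] at h2
  split_ifs at h2 with h3
  · rwa [← h3]
  · simp at h2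

/-! ### Minimal coset representatives -/

/-- The elements of minimal length in their left coset of the subgroup generated by `K`. -/
def minimalReps (K : Set W) : Set W :=
  {w | ∀ v ∈ Subgroup.closure K, cs.length w ≤ cs.length (w * v)}

theorem invParity_of_mem_minimalReps {K : Set W} {x t : W} (hx : x ∈ minimalReps cs K)
    (ht : t ∈ Subgroup.closure K) : invParity cs x t = 0 := by
  rw [← zmod_two_ne_one]
  intro h
  have := length_lt_of_invParity cs h
  have := hx t ht
  omega

theorem exists_minimalRep (K : Set W) (w : W) :
    ∃ x ∈ minimalReps cs K, x⁻¹ * w ∈ Subgroup.closure K := by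
  classical
  have hne : ∃ n, ∃ x, x⁻¹ * w ∈ Subgroup.closure K ∧ cs.length x = n :=
    ⟨_, w, by simp [one_mem], rfl⟩
  obtain ⟨x, hx, hn⟩ := Nat.find_spec hne
  refine ⟨x, fun v hv => ?_, hx⟩
  rw [hn]
  refine Nat.find_min' hne ⟨x * v, ?_, rfl⟩
  rw [mul_inv_rev, mul_assoc]
  exact mul_mem (inv_mem hv) hx

/-- The representative of minimal length of the left coset of `w`. -/
def minimalRep (K : Set W) (w : W) : W := (exists_minimalRep cs K w).choose

theorem minimalRep_mem (K : Set W) (w : W) : minimalRep cs K w ∈ minimalReps cs K :=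
  (exists_minimalRep cs K w).choose_spec.1

theorem minimalRep_inv_mul_mem (K : Set W) (w : W) :
    (minimalRep cs K w)⁻¹ * w ∈ Subgroup.closure K :=
  (exists_minimalRep cs K w).choose_spec.2

/-- Since x has no inversions in W_K, any descent of u in K survives in x u. This gives both the
local test for minimality and uniqueness of the minimal representative. -/
theorem eq_one_of_minimalReps {K : Set W} (hK : K ⊆ Set.range cs.simple) {x u : W}
    (hx : x ∈ minimalReps cs K) (hu : u ∈ Subgroup.closure K)
    (hxu : ∀ s ∈ K, invParity cs (x * u) s = 0) : u = 1 := by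
  by_contra h1
  obtain ⟨s, hs, h⟩ := exists_invParity_of_ne_one cs hK hu h1
  have h2 := hxu s hs
  rw [invParity_mul, h, invParity_of_mem_minimalReps cs hx
    (mul_mem (mul_mem hu (Subgroup.subset_closure hs)) (inv_mem hu))] at h2
  simp at h2

theorem mem_minimalReps_iff {K : Set W} (hK : K ⊆ Set.range cs.simple) {w : W} :
    w ∈ minimalReps cs K ↔ ∀ s ∈ K, invParity cs w s = 0 := by
  refine ⟨fun h s hs => invParity_of_mem_minimalReps cs h (Subgroup.subset_closure hs),
    fun h => ?_⟩
  have h1 := eq_one_of_minimalReps cs hK (minimalRep_mem cs K w) (minimalRep_inv_mul_mem cs K w)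
    (by simpa using h)
  rw [inv_mul_eq_one] at h1
  rw [← h1]
  exact minimalRep_mem cs K w

theorem minimalRep_mul {K : Set W} (hK : K ⊆ Set.range cs.simple) {x u : W}
    (hx : x ∈ minimalReps cs K) (hu : u ∈ Subgroup.closure K) :
    minimalRep cs K (x * u) = x := by
  set y := minimalRep cs K (x * u) with hy
  have h1 : y⁻¹ * (x * u) ∈ Subgroup.closure K := minimalRep_inv_mul_mem cs K (x * u)
  have h2 : y⁻¹ * x ∈ Subgroup.closure K := by
    have := mul_mem h1 (inv_mem hu); simpa [mul_assoc] using this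
  have h3 := eq_one_of_minimalReps cs hK (minimalRep_mem cs K (x * u)) h2
    (by rw [← hy]; simpa using (mem_minimalReps_iff cs hK).1 hx)
  rwa [inv_mul_eq_one] at h3

/-! ### Double cosets and Solomon's product formula -/

/-- The elements `d` such that `d` is minimal in `d W_K` and in `W_J d`. -/
def doubleReps (J K : Set W) : Set W :=
  {d | d⁻¹ ∈ minimalReps cs J ∧ d ∈ minimalReps cs K}

/-- The elements of `K` that are conjugated into `W_J` by `d`. -/
def conjInter (J K : Set W) (d : W) : Set W :=
  {s ∈ K | d * s * d⁻¹ ∈ Subgroup.closure J}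

theorem conjInter_subset (J K : Set W) (d : W) : conjInter J K d ⊆ K := Set.sep_subset _ _

theorem invParity_of_conj_mem {J : Set W} {d : W} (hd : d⁻¹ ∈ minimalReps cs J) {s : W}
    (h : d * s * d⁻¹ ∈ Subgroup.closure J) : invParity cs d s = 0 := by
  rw [← zmod_two_ne_one]
  intro h1
  have h2 := length_lt_of_invParity cs h1
  have h3 := hd _ (inv_mem h)
  rw [show d⁻¹ * (d * s * d⁻¹)⁻¹ = (d * s)⁻¹ by group, cs.length_inv, cs.length_inv] at h3
  omega

/-- A descent s of d that disappears in u d makes d s d⁻¹ an inversion of u, hence an element of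
W_J; minimality of d in W_J d then excludes s as a descent of d. -/
theorem mem_minimalReps_of_mul {J K : Set W} (hJ : J ⊆ Set.range cs.simple)
    (hK : K ⊆ Set.range cs.simple) {u d : W}
    (hu : u ∈ Subgroup.closure J) (hd : d⁻¹ ∈ minimalReps cs J)
    (h : u * d ∈ minimalReps cs K) : d ∈ minimalReps cs K := by
  rw [mem_minimalReps_iff cs hK] at h ⊢
  intro s hs
  rw [← zmod_two_ne_one]
  intro h1
  have h2 := h s hs
  rw [invParity_mul, h1] at h2
  have h3 : invParity cs u (d * s * d⁻¹) = 1 := by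
    revert h2; generalize invParity cs u (d * s * d⁻¹) = a; revert a; decide
  have := invParity_of_conj_mem cs hd (mem_closure_of_invParity cs hJ hu h3)
  rw [h1] at this
  simp at this

/-- A descent s' ∈ J of v = d s d⁻¹ is also an inversion of d⁻¹v = s d⁻¹. As d⁻¹ has no inversion in
W_J, the cocycle identity forces d⁻¹ s' d = s, so v = s'. -/
theorem conj_mem_of_conj_mem_closure {J : Set W} (hJ : J ⊆ Set.range cs.simple) {d : W} {i : B}
    (hd : d⁻¹ ∈ minimalReps cs J)
    (h : d * cs.simple i * d⁻¹ ∈ Subgroup.closure J) : d * cs.simple i * d⁻¹ ∈ J := by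
  classical
  set v := d * cs.simple i * d⁻¹ with hv
  have h1 : v ≠ 1 := by
    intro h1
    have h2 : cs.simple i = 1 := by
      rw [hv] at h1
      calc cs.simple i = d⁻¹ * (d * cs.simple i * d⁻¹) * d := by group
        _ = 1 := by rw [h1]; group
    have := cs.length_simple i
    rw [h2, cs.length_one] at this
    omega
  obtain ⟨s', hs', h2⟩ := exists_invParity_of_ne_one cs hJ h h1
  have h3 : invParity cs (d⁻¹ * v) s' = 1 := by
    rw [invParity_mul, h2, invParity_of_mem_minimalReps cs hd
      (mul_mem (mul_mem h (Subgroup.subset_closure hs')) (inv_mem h)), add_zero]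
  rw [show d⁻¹ * v = cs.simple i * d⁻¹ by rw [hv]; group, invParity_mul,
    invParity_of_mem_minimalReps cs hd (Subgroup.subset_closure hs'), zero_add,
    invParity_simple] at h3
  split_ifs at h3 with h4
  · have : v = s' := by rw [hv, ← h4]; group
    rwa [this]
  · simp at h3

/-- Kilmoyer's theorem on the intersection of parabolic subgroups. -/
theorem mem_closure_conjInter_iff {J K : Set W} (hJ : J ⊆ Set.range cs.simple)
    (hK : K ⊆ Set.range cs.simple) {d : W} (hd : d ∈ doubleReps cs J K) {v : W}
    (hv : v ∈ Subgroup.closure K) :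
    v ∈ Subgroup.closure (conjInter J K d) ↔ d * v * d⁻¹ ∈ Subgroup.closure J := by
  constructor
  · intro h
    clear hv
    induction h using Subgroup.closure_induction with
    | mem x hx => exact hx.2
    | one => simp [one_mem]
    | mul x y _ _ hx hy => simpa [mul_assoc] using mul_mem hx hy
    | inv x _ hx => simpa [mul_assoc] using inv_mem hx
  · intro h
    induction hn : cs.length v using Nat.strong_induction_on generalizing v with
    | _ n ih =>
    by_cases h1 : v = 1
    · rw [h1]; exact one_mem _
    · obtain ⟨s, hs, h2⟩ := exists_invParity_of_ne_one cs hK hv h1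
      have h3 : invParity cs (d * v) s = 1 := by
        rw [invParity_mul, h2, invParity_of_mem_minimalReps cs hd.2
          (mul_mem (mul_mem hv (Subgroup.subset_closure hs)) (inv_mem hv)), add_zero]
      rw [show d * v = (d * v * d⁻¹) * d by group, invParity_mul,
        invParity_of_mem_minimalReps cs hd.2 (Subgroup.subset_closure hs), zero_add] at h3
      -- The descent s of v is an inversion of d v = (d v d⁻¹) d but not of d, so d s d⁻¹ is an
      -- inversion of d v d⁻¹ ∈ W_J. Thus s can be stripped from v.
      have h4 := mem_closure_of_invParity cs hJ h h3
      have hsI : s ∈ Subgroup.closure (conjInter J K d) := Subgroup.subset_closure ⟨hs, h4⟩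
      have h5 := ih _ (by rw [← hn]; exact length_lt_of_invParity cs h2)
        (mul_mem hv (Subgroup.subset_closure hs))
        (by simpa [mul_assoc] using mul_mem h h4) rfl
      simpa using mul_mem h5 (inv_mem hsI)

theorem invParity_mul_mul {J : Set W} {x u d s : W} (hx : x ∈ minimalReps cs J)
    (hu : u ∈ Subgroup.closure J) (h : d * s * d⁻¹ ∈ Subgroup.closure J) :
    invParity cs (x * (u * d)) s = invParity cs (u * d) s := by
  rw [invParity_mul, invParity_of_mem_minimalReps cs hx, add_zero]
  have := mul_mem (mul_mem hu h) (inv_mem hu)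
  simpa [mul_assoc] using this

/-- Elements s ∈ K with d s d⁻¹ ∉ W_J are never descents of u d, and at the remaining ones x
contributes no inversion. This is what makes the bijection in Solomon's formula work. -/
theorem mul_mem_minimalReps_iff {J K : Set W} (hJ : J ⊆ Set.range cs.simple)
    (hK : K ⊆ Set.range cs.simple) {x u d : W} (hx : x ∈ minimalReps cs J)
    (hu : u ∈ Subgroup.closure J) (hd : d ∈ doubleReps cs J K) :
    x * (u * d) ∈ minimalReps cs (conjInter J K d) ↔ u * d ∈ minimalReps cs K := by
  rw [mem_minimalReps_iff cs hK, mem_minimalReps_iff cs ((conjInter_subset J K d).trans hK)]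
  constructor
  · intro h s hs
    by_cases h1 : d * s * d⁻¹ ∈ Subgroup.closure J
    · rw [← invParity_mul_mul cs hx hu h1]
      exact h s ⟨hs, h1⟩
    · rw [invParity_mul, invParity_of_mem_minimalReps cs hd.2 (Subgroup.subset_closure hs),
        zero_add, ← zmod_two_ne_one]
      exact fun h2 => h1 (mem_closure_of_invParity cs hJ hu h2)
  · intro h s hs
    rw [invParity_mul_mul cs hx hu hs.2]
    exact h s hs.1

/-- A fixed coset corresponds to the inverse d of its minimal representative. Being fixed says d K
d⁻¹ ⊆ W_J, which already makes d minimal in d W_K. -/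
theorem card_fixedPoints_eq {J K : Set W} (hJ : J ⊆ Set.range cs.simple)
    (hK : K ⊆ Set.range cs.simple) :
    Nat.card (MulAction.fixedPoints (Subgroup.closure K) (W ⧸ Subgroup.closure J)) =
      Nat.card {d // d ∈ doubleReps cs J K ∧ conjInter J K d = K} := by
  have hfix : ∀ w : W, (w : W ⧸ Subgroup.closure J) ∈
      MulAction.fixedPoints (Subgroup.closure K) (W ⧸ Subgroup.closure J) ↔
      ∀ s ∈ K, w⁻¹ * s * w ∈ Subgroup.closure J := by
    intro w
    have h1 : ∀ h : W, ((h * w : W) : W ⧸ Subgroup.closure J) = w ↔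
        w⁻¹ * h * w ∈ Subgroup.closure J := by
      intro h
      rw [eq_comm, QuotientGroup.eq, mul_assoc]
    constructor
    · intro h s hs
      rw [← h1]
      exact h ⟨s, Subgroup.subset_closure hs⟩
    · rintro h ⟨x, hx⟩
      change ((x * w : W) : W ⧸ Subgroup.closure J) = w
      rw [h1]
      induction hx using Subgroup.closure_induction with
      | mem x hx => exact h x hx
      | one => simp [one_mem]
      | mul x y _ _ hx hy => simpa [mul_assoc] using mul_mem hx hy
      | inv x _ hx => simpa [mul_assoc] using inv_mem hx
  symm
  refine Nat.card_eq_of_bijective (fun d => ⟨((d.1⁻¹ : W) : W ⧸ Subgroup.closure J), ?_⟩)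
    ⟨?_, ?_⟩
  · rw [hfix]
    intro s hs
    have := d.2.2
    rw [← this] at hs
    simpa using hs.2
  · rintro ⟨d, hd, _⟩ ⟨d', hd', _⟩ h
    have h1 := Subtype.mk.inj h
    rw [QuotientGroup.eq] at h1
    have h2 := minimalRep_mul cs hJ hd.1 h1
    rw [mul_inv_cancel_left] at h2
    have h3 := minimalRep_mul cs hJ hd'.1 (one_mem _)
    rw [mul_one, h2] at h3
    exact Subtype.ext (inv_injective h3)
  · rintro ⟨q, hq⟩
    obtain ⟨w, rfl⟩ := QuotientGroup.mk_surjective q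
    have hw : ((minimalRep cs (J) w : W) : W ⧸ Subgroup.closure J) = w :=
      QuotientGroup.eq.2 (minimalRep_inv_mul_mem cs J w)
    have hq' : ∀ s ∈ K, (minimalRep cs J w)⁻¹ * s * (minimalRep cs J w)⁻¹⁻¹ ∈
        Subgroup.closure J := by
      rw [inv_inv]
      refine (hfix _).1 ?_
      rw [hw]; exact hq
    have hx : (minimalRep cs J w)⁻¹⁻¹ ∈ minimalReps cs J := by
      rw [inv_inv]; exact minimalRep_mem cs J w
    refine ⟨⟨(minimalRep cs J w)⁻¹, ⟨hx, ?_⟩, ?_⟩, ?_⟩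
    · rw [mem_minimalReps_iff cs hK]
      exact fun s hs => invParity_of_conj_mem cs hx (hq' s hs)
    · exact Set.sep_eq_self_iff_mem_true.2 hq'
    · simpa using hw

/-! ### Sums of minimal representatives in the group algebra. -/

section Finite

variable [Finite W]

/-- The sum of the minimal coset representatives for the subgroup generated by `K`. -/
def repSum (K : Set W) : MonoidAlgebra ℚ W :=
  ∑ w ∈ (Set.toFinite (minimalReps cs K)).toFinset, MonoidAlgebra.of ℚ W w

theorem xElt_eq (J : Set B) : xElt cs J = repSum cs (cs.simple '' J) := rfl

/-- Solomon's theorem. -/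
theorem repSum_mul_repSum {J K : Set W} (hJ : J ⊆ Set.range cs.simple)
    (hK : K ⊆ Set.range cs.simple) :
    repSum cs J * repSum cs K =
      ∑ d ∈ (Set.toFinite (doubleReps cs J K)).toFinset, repSum cs (conjInter J K d) := by
  simp only [repSum]
  rw [Finset.sum_mul_sum, ← Finset.sum_product', Finset.sum_sigma']
  have hinv : ∀ b : W, b * minimalRep cs J b⁻¹ ∈ Subgroup.closure J := by
    intro b
    have := inv_mem (minimalRep_inv_mul_mem cs J b⁻¹)
    simpa using this
  -- Write b = u d with u ∈ W_J and d minimal in W_J b, and send (a, b) to (d, a b). The inverse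
  -- recovers a as the minimal representative of w d⁻¹ = a u.
  refine Finset.sum_bij'
    (fun x _ => (⟨(minimalRep cs J x.2⁻¹)⁻¹, x.1 * x.2⟩ : Σ _ : W, W))
    (fun y _ => (minimalRep cs J (y.2 * y.1⁻¹), (minimalRep cs J (y.2 * y.1⁻¹))⁻¹ * y.2))
    ?_ ?_ ?_ ?_ ?_
  · rintro ⟨a, b⟩ h
    simp only [Finset.mem_product, Set.Finite.mem_toFinset, Finset.mem_sigma] at h ⊢
    have hu := hinv b
    have hd : ((minimalRep cs J b⁻¹)⁻¹)⁻¹ ∈ minimalReps cs J := by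
      rw [inv_inv]; exact minimalRep_mem cs J _
    have hb : b = b * minimalRep cs J b⁻¹ * (minimalRep cs J b⁻¹)⁻¹ := by simp
    have h2 := h.2
    rw [hb] at h2
    have hD : (minimalRep cs J b⁻¹)⁻¹ ∈ doubleReps cs J K :=
      ⟨hd, mem_minimalReps_of_mul cs hJ hK hu hd h2⟩
    refine ⟨hD, ?_⟩
    have := (mul_mem_minimalReps_iff cs hJ hK h.1 hu hD).2 h2
    rwa [← hb] at this
  · rintro ⟨d, w⟩ h
    simp only [Finset.mem_product, Set.Finite.mem_toFinset, Finset.mem_sigma] at h ⊢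
    refine ⟨minimalRep_mem cs J _, ?_⟩
    have hu := minimalRep_inv_mul_mem cs J (w * d⁻¹)
    have := mul_mem_minimalReps_iff cs hJ hK (minimalRep_mem cs J (w * d⁻¹)) hu h.1
    simp only [mul_assoc, inv_mul_cancel, mul_one, mul_inv_cancel_left] at this
    exact this.1 h.2
  · rintro ⟨a, b⟩ h
    simp only [Finset.mem_product, Set.Finite.mem_toFinset] at h
    have := minimalRep_mul cs hJ h.1 (hinv b)
    simp only [inv_inv, mul_assoc, this, inv_mul_cancel_left]
  · rintro ⟨d, w⟩ h
    simp only [Set.Finite.mem_toFinset, Finset.mem_sigma] at h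
    have hu := minimalRep_inv_mul_mem cs J (w * d⁻¹)
    have := minimalRep_mul cs hJ h.1.1 (inv_mem hu)
    rw [show d⁻¹ * ((minimalRep cs J (w * d⁻¹))⁻¹ * (w * d⁻¹))⁻¹ =
      ((minimalRep cs J (w * d⁻¹))⁻¹ * w)⁻¹ by group] at this
    simp only [this, inv_inv, mul_inv_cancel_left]
  · rintro ⟨a, b⟩ h
    simp

open scoped Classical in
theorem repSum_mul_repSum_eq_add {J K : Set W} (hJ : J ⊆ Set.range cs.simple)
    (hK : K ⊆ Set.range cs.simple) :
    repSum cs J * repSum cs K =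
      (Nat.card (MulAction.fixedPoints (Subgroup.closure K) (W ⧸ Subgroup.closure J)) : ℚ) •
        repSum cs K +
      ∑ d ∈ (Set.toFinite (doubleReps cs J K)).toFinset with conjInter J K d ≠ K,
        repSum cs (conjInter J K d) := by
  rw [repSum_mul_repSum cs hJ hK, card_fixedPoints_eq cs hJ hK,
    ← Finset.sum_filter_add_sum_filter_not _ (fun d => conjInter J K d = K)]
  congr 1
  rw [Finset.sum_congr rfl (g := fun _ => repSum cs K)
    (fun d hd => by rw [(Finset.mem_filter.1 hd).2]), Finset.sum_const, Nat.cast_smul_eq_nsmul]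
  congr 1
  rw [← Nat.card_eq_finsetCard]
  exact Nat.card_congr (Equiv.subtypeEquivRight fun d => by simp)

theorem repSum_apply (K : Set W) (w : W) [Decidable (w ∈ minimalReps cs K)] :
    (repSum cs K).coeff w = if w ∈ minimalReps cs K then 1 else 0 := by
  classical
  simp [repSum, Finsupp.single_apply]

/-- The witness is a longest element of the subgroup generated by S \ K: by maximality every element
of S \ K is a descent, and its descents all lie in that subgroup. Evaluating at it makes the x_L
unitriangular. -/
theorem exists_descents_eq (K : Set W) :
    ∃ w : W, ∀ L ⊆ Set.range cs.simple, w ∈ minimalReps cs L ↔ L ⊆ K := by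
  obtain ⟨w, hw⟩ := Finite.exists_max
    (fun w : Subgroup.closure (Set.range cs.simple \ K) => cs.length w.1)
  refine ⟨w, fun L hL => ?_⟩
  rw [mem_minimalReps_iff cs hL]
  have key : ∀ i, invParity cs w.1 (cs.simple i) = 1 ↔ cs.simple i ∉ K := by
    intro i
    constructor
    · intro h
      exact (mem_of_simple_mem_closure cs Set.sdiff_subset
        (mem_closure_of_invParity cs Set.sdiff_subset w.2 h)).2
    · intro h
      rw [invParity_eq_one_iff]
      have h1 := hw (w * ⟨cs.simple i, Subgroup.subset_closure ⟨⟨i, rfl⟩, h⟩⟩)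
      exact lt_of_le_of_ne h1 (cs.length_mul_simple_ne _ _)
  constructor
  · intro h s hs
    obtain ⟨i, rfl⟩ := hL hs
    by_contra h'
    have := (key i).2 h'
    rw [h _ hs] at this
    simp at this
  · intro h s hs
    obtain ⟨i, rfl⟩ := hL hs
    rw [← zmod_two_ne_one, Ne, key, not_not]
    exact h hs

theorem linearIndependent_repSum :
    LinearIndependent ℚ (fun K : {K : Set W // K ⊆ Set.range cs.simple} => repSum cs K.1) := by
  classical
  have := Fintype.ofFinite {K : Set W // K ⊆ Set.range cs.simple}
  rw [Fintype.linearIndependent_iff]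
  intro g hg K
  induction hn : K.1.ncard using Nat.strong_induction_on generalizing K with
  | _ n ih =>
  obtain ⟨w, hw⟩ := exists_descents_eq cs K.1
  have h1 := congrArg (fun f : MonoidAlgebra ℚ W => f.coeff w) hg
  simp only [MonoidAlgebra.coeff_sum, MonoidAlgebra.coeff_smul, Finsupp.finsetSum_apply,
    Finsupp.smul_apply, repSum_apply, MonoidAlgebra.coeff_zero, Finsupp.zero_apply,
    smul_eq_mul, mul_ite, mul_one, mul_zero] at h1
  rw [Finset.sum_eq_single K] at h1
  · rwa [if_pos ((hw K.1 K.2).2 subset_rfl)] at h1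
  · intro L _ hL
    rw [hw L.1 L.2]
    split_ifs with h
    · refine ih _ ?_ L rfl
      rw [← hn]
      exact Set.ncard_lt_ncard (h.ssubset_of_ne fun h' => hL (Subtype.ext h'))
    · rfl
  · simp

end Finite

end Descent

end

noncomputable section

/-! ### Irreducible representations of rings with a triangular spanning family -/

theorem IsGivenByCharacter.isIrreducibleRep {A F k V : Type*} [Ring A] [Field F] [Field k]
    [Algebra F k] [AddCommGroup V] [Module k V] {ρ : A →+* Module.End k V} {f : A →+* F}
    (h : IsGivenByCharacter ρ f) : IsIrreducibleRep ρ := by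
  have := Module.nontrivial_of_finrank_eq_succ h.1
  have hs : IsSimpleModule k V := isSimpleModule_iff_finrank_eq_one.2 h.1
  exact ⟨this, fun U _ => eq_bot_or_eq_top U⟩

/-- If the left multiplications by the elements `e J`, which generate `A` together with scalars,
are triangular with respect to the family `e` itself, then the diagonal characters are the only
irreducible representations. -/
theorem IsIrreducibleRep.exists_isGivenByCharacter {ι A F k V : Type*} [PartialOrder ι] [Finite ι]
    [Ring A] [Field F] [Field k] [Algebra F k] [AddCommGroup V] [Module k V]
    {ρ : A →+* Module.End k V} (hρ : IsIrreducibleRep ρ) (e : ι → A) (f : ι → A →+* F)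
    (m : ι → ι → ℕ) (C : Set A)
    (hgen : ∀ T : Subring A, Set.range e ⊆ T → C ⊆ T → T = ⊤)
    (hC : ∀ c ∈ C, ∀ K v, ρ c v = algebraMap F k (f K c) • v)
    (hone : ∃ K, e K = 1) (hf : ∀ J K, f K (e J) = m J K)
    (hmul : ∀ J K, ∃ y ∈ AddSubgroup.closure (e '' Set.Iio K),
      e J * e K = (m J K : A) * e K + y) :
    ∃ K, IsGivenByCharacter ρ (f K) := by
  obtain ⟨hnt, hirr⟩ := hρ
  obtain ⟨K₀, hK₀⟩ := hone
  -- Minimality of K annihilates the lower-order terms of every product e J * e K.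
  obtain ⟨K, hK, hmin⟩ := Set.Finite.exists_minimal (s := {K | ρ (e K) ≠ 0}) (Set.toFinite _)
    ⟨K₀, by simp [hK₀]⟩
  have hlow : ∀ y ∈ AddSubgroup.closure (e '' Set.Iio K), ρ y = 0 := by
    intro y hy
    induction hy using AddSubgroup.closure_induction with
    | mem y hy =>
      obtain ⟨L, hL, rfl⟩ := hy
      by_contra h
      exact absurd (hmin h hL.le) (not_le_of_gt hL)
    | zero => simp
    | add x y _ _ hx hy => simp [hx, hy]
    | neg x _ hx => simp [hx]
  -- The elements acting on the image of ρ (e K) through f K; the generators belong to it.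
  let T : Subring A :=
    { carrier := {a | ∀ v, ρ a (ρ (e K) v) = algebraMap F k (f K a) • ρ (e K) v}
      mul_mem' := by
        intro a b ha hb v
        rw [map_mul, Module.End.mul_apply, hb, map_smul, ha, map_mul, map_mul, smul_smul, mul_comm]
      one_mem' := by intro v; simp
      add_mem' := by
        intro a b ha hb v
        rw [map_add, LinearMap.add_apply, ha, hb, map_add, map_add, add_smul]
      zero_mem' := by intro v; simp
      neg_mem' := by
        intro a ha v
        rw [map_neg, LinearMap.neg_apply, ha, map_neg, map_neg, neg_smul] }
  have hT : T = ⊤ := by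
    refine hgen T ?_ (fun c hc v => hC c hc K _)
    rintro _ ⟨J, rfl⟩ v
    obtain ⟨y, hy, h⟩ := hmul J K
    rw [← Module.End.mul_apply, ← map_mul, h, map_add, hlow y hy, add_zero, map_mul, hf,
      map_natCast, map_natCast, Module.End.mul_apply, Module.End.natCast_apply, Nat.cast_smul_eq_nsmul]
  have hact : ∀ a v, ρ a (ρ (e K) v) = algebraMap F k (f K a) • ρ (e K) v := fun a => by
    have : a ∈ T := by rw [hT]; trivial
    exact this
  obtain ⟨v, hv⟩ : ∃ v, ρ (e K) v ≠ 0 := by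
    by_contra! h
    exact hK (LinearMap.ext h)
  have htop : Submodule.span k {ρ (e K) v} = ⊤ := by
    refine (hirr _ ?_).resolve_left (by simpa [Submodule.span_singleton_eq_bot] using hv)
    intro a u hu
    obtain ⟨c, rfl⟩ := Submodule.mem_span_singleton.1 hu
    rw [map_smul, hact]
    exact Submodule.smul_mem _ _ (Submodule.smul_mem _ _ (Submodule.mem_span_singleton_self _))
  refine ⟨K, finrank_eq_one _ hv fun w => ?_, fun a w => ?_⟩
  · exact Submodule.mem_span_singleton.1 (htop ▸ Submodule.mem_top)
  · obtain ⟨c, rfl⟩ := Submodule.mem_span_singleton.1 (htop ▸ Submodule.mem_top (x := w))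
    rw [map_smul, hact, smul_comm]

/-! ### Triangular products inside the descent algebra and its integral form. -/

namespace Descent

variable {B W : Type*} [Group W] {M : CoxeterMatrix B} (cs : CoxeterSystem M W)

/-- The number of fixed points on `W / ⟨J⟩` of the subgroup generated by `K`. -/
def fixCount (J K : Set W) : ℕ :=
  Nat.card (MulAction.fixedPoints (Subgroup.closure K) (W ⧸ Subgroup.closure J))

theorem mark_eq (J K : Set B) : mark cs J K = fixCount (cs.simple '' J) (cs.simple '' K) := rfl

section Finite

variable [Finite W]

theorem repSum_eq_xElt {L : Set W} (hL : L ⊆ Set.range cs.simple) :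
    repSum cs L = xElt cs (cs.simple ⁻¹' L) := by
  rw [xElt_eq, Set.image_preimage_eq_of_subset hL]

theorem repSum_range : repSum cs (Set.range cs.simple) = 1 := by
  classical
  have h : minimalReps cs (Set.range cs.simple) = {1} := by
    ext w
    rw [Set.mem_singleton_iff]
    constructor
    · intro h
      have := h w⁻¹ (by rw [cs.subgroup_closure_range_simple]; trivial)
      rwa [mul_inv_cancel, cs.length_one, Nat.le_zero, cs.length_eq_zero_iff] at this
    · rintro rfl v _
      simp
  rw [repSum, Finset.sum_congr (s₂ := {1}) (by ext; simp [h]) (fun _ _ => rfl),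
    Finset.sum_singleton, map_one]

/-- The subsets of `S`. -/
abbrev SimpleSubset : Type _ := {K : Set W // K ⊆ Set.range cs.simple}

/-- Solomon's theorem, in a subring containing the sums of minimal coset representatives. -/
theorem mul_eq_natCast_mul_add {T : Type*} [SetLike T (MonoidAlgebra ℚ W)]
    [SubringClass T (MonoidAlgebra ℚ W)] (A : T)
    (hA : ∀ L : SimpleSubset cs, repSum cs L.1 ∈ A) (J K : SimpleSubset cs) :
    ∃ y ∈ AddSubgroup.closure
        ((fun L : SimpleSubset cs => (⟨repSum cs L.1, hA L⟩ : A)) '' Set.Iio K),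
      (⟨repSum cs J.1, hA J⟩ * ⟨repSum cs K.1, hA K⟩ : A) =
        (fixCount J.1 K.1 : A) * ⟨repSum cs K.1, hA K⟩ + y := by
  classical
  refine ⟨∑ d ∈ (Set.toFinite (doubleReps cs J.1 K.1)).toFinset with conjInter J.1 K.1 d ≠ K.1,
    ⟨repSum cs (conjInter J.1 K.1 d), hA ⟨_, (conjInter_subset _ _ d).trans K.2⟩⟩, ?_, ?_⟩
  · refine sum_mem fun d hd => AddSubgroup.subset_closure ?_
    refine ⟨⟨_, (conjInter_subset J.1 K.1 d).trans K.2⟩, ?_, rfl⟩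
    exact LE.le.ssubset_of_ne (conjInter_subset J.1 K.1 d) (Finset.mem_filter.1 hd).2
  · refine Subtype.ext ?_
    have := repSum_mul_repSum_eq_add cs J.2 K.2
    rw [Nat.cast_smul_eq_nsmul, nsmul_eq_mul] at this
    push_cast
    exact this

/-! ### The characters of the descent algebra -/

/-- The span U of the x_L with L ⊊ K is stable under left multiplication, and a x_K is a multiple of
x_K modulo U. The character is that multiple. -/
theorem exists_character {K : Set W} (hK : K ⊆ Set.range cs.simple) :
    ∃ f : descentAlgebra cs →+* ℚ,
      ∀ J : Set B, f (xDescent cs J) = fixCount (cs.simple '' J) K := by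
  classical
  set U : Submodule ℚ (MonoidAlgebra ℚ W) :=
    Submodule.span ℚ ((fun L : SimpleSubset cs => repSum cs L.1) '' Set.Iio ⟨K, hK⟩)
  have hnot : repSum cs K ∉ U :=
    (linearIndependent_repSum cs).notMem_span_image (x := ⟨K, hK⟩) (by simp)
  -- The functional φ reads off the coefficient of x_K modulo U; it exists because x_K ∉ U.
  obtain ⟨φ, hφ1, hφU⟩ : ∃ φ : MonoidAlgebra ℚ W →ₗ[ℚ] ℚ, φ (repSum cs K) = 1 ∧ ∀ u ∈ U, φ u = 0 := by
    obtain ⟨φ, h1, h2⟩ := Submodule.exists_le_ker_of_notMem hnot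
    refine ⟨(φ (repSum cs K))⁻¹ • φ, by simp [h1], fun u hu => ?_⟩
    have : φ u = 0 := h2 hu
    simp [this]
  have hmul : ∀ J : Set B, ∀ L ⊆ Set.range cs.simple, ∃ y ∈ Submodule.span ℚ
      ((fun L : SimpleSubset cs => repSum cs L.1) '' {I | I.1 ⊂ L}),
      xElt cs J * repSum cs L =
        (fixCount (cs.simple '' J) L : ℚ) • repSum cs L + y := by
    intro J L hL
    refine ⟨_, ?_, repSum_mul_repSum_eq_add cs (Set.image_subset_range _ _) hL⟩
    refine sum_mem fun d hd => Submodule.subset_span ?_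
    exact ⟨⟨_, (conjInter_subset _ L d).trans hL⟩, 
      (conjInter_subset _ L d).ssubset_of_ne (Finset.mem_filter.1 hd).2, rfl⟩
  have hstab : ∀ a ∈ descentAlgebra cs, (∀ u ∈ U, a * u ∈ U) ∧
      ∃ c : ℚ, a * repSum cs K - c • repSum cs K ∈ U := by
    intro a ha
    induction ha using Algebra.adjoin_induction with
    | mem a ha =>
      obtain ⟨J, rfl⟩ := ha
      constructor
      · intro u hu
        induction hu using Submodule.span_induction with
        | mem u hu =>
          obtain ⟨L, hL, rfl⟩ := hu
          obtain ⟨y, hy, h⟩ := hmul J L.1 L.2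
          simp only [h]
          refine add_mem (Submodule.smul_mem _ _ (Submodule.subset_span ⟨L, hL, rfl⟩))
            (Submodule.span_mono (Set.image_mono ?_) hy)
          intro I hI
          exact lt_trans (show I < L from hI) hL
        | zero => simp
        | add x y _ _ hx hy => rw [mul_add]; exact add_mem hx hy
        | smul c x _ hx => rw [mul_smul_comm]; exact Submodule.smul_mem _ _ hx
      · obtain ⟨y, hy, h⟩ := hmul J K hK
        refine ⟨fixCount (cs.simple '' J) K, ?_⟩
        rw [h, add_sub_cancel_left]
        exact Submodule.span_mono (Set.image_mono fun I hI => hI) hy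
    | algebraMap r =>
      refine ⟨fun u hu => ?_, r, ?_⟩
      · rw [← Algebra.smul_def]; exact Submodule.smul_mem _ _ hu
      · rw [← Algebra.smul_def, sub_self]; exact zero_mem _
    | add x y _ _ hx hy =>
      obtain ⟨hx, c, hc⟩ := hx
      obtain ⟨hy, d, hd⟩ := hy
      refine ⟨fun u hu => ?_, c + d, ?_⟩
      · rw [add_mul]; exact add_mem (hx u hu) (hy u hu)
      · rw [add_mul, add_smul, add_sub_add_comm]; exact add_mem hc hd
    | mul x y _ _ hx hy =>
      obtain ⟨hx, c, hc⟩ := hx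
      obtain ⟨hy, d, hd⟩ := hy
      refine ⟨fun u hu => ?_, d * c, ?_⟩
      · rw [mul_assoc]; exact hx _ (hy u hu)
      · have := add_mem (hx _ hd) (Submodule.smul_mem _ d hc)
        rw [mul_sub, mul_smul_comm, smul_sub, smul_smul, sub_add_sub_cancel, ← mul_assoc] at this
        exact this
  have hφ : ∀ a ∈ descentAlgebra cs,
      a * repSum cs K - φ (a * repSum cs K) • repSum cs K ∈ U := by
    intro a ha
    obtain ⟨c, hc⟩ := (hstab a ha).2
    have h := hφU _ hc
    rw [map_sub, map_smul, hφ1, smul_eq_mul, mul_one, sub_eq_zero] at h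
    rwa [h]
  refine ⟨{ toFun := fun a => φ (a * repSum cs K)
            map_one' := by simp [hφ1]
            map_zero' := by simp
            map_add' := fun a b => by simp [add_mul]
            map_mul' := fun a b => ?_ }, fun J => ?_⟩
  · have h := hφU _ ((hstab a.1 a.2).1 _ (hφ b.1 b.2))
    rw [mul_sub, mul_smul_comm, map_sub, map_smul, smul_eq_mul, sub_eq_zero, ← mul_assoc] at h
    simpa [mul_comm] using h
  · obtain ⟨y, hy, h⟩ := hmul J K hK
    change φ (xElt cs J * repSum cs K) = _
    have hyU : y ∈ U := Submodule.span_mono (Set.image_mono fun I hI => hI) hy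
    rw [h, map_add, map_smul, hφ1, hφU y hyU]
    simp

theorem integralForm_le : (integralForm cs : Set (MonoidAlgebra ℚ W)) ⊆ descentAlgebra cs := by
  have : integralForm cs ≤ (descentAlgebra cs).toSubring :=
    Subring.closure_le.2 Algebra.subset_adjoin
  exact this

theorem exists_integral_character {K : Set W} (hK : K ⊆ Set.range cs.simple) :
    ∃ f : integralForm cs →+* ℤ,
      ∀ J : Set B, f (xIntegral cs J) = fixCount (cs.simple '' J) K := by
  obtain ⟨f, hf⟩ := exists_character cs hK
  let g : integralForm cs →+* ℚ := f.comp
    (Subring.inclusion (show integralForm cs ≤ (descentAlgebra cs).toSubring from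
      integralForm_le cs))
  have hg : ∀ a, g a ∈ (Int.castRingHom ℚ).range := by
    rintro ⟨a, ha⟩
    induction ha using Subring.closure_induction with
    | mem a ha =>
      obtain ⟨J, rfl⟩ := ha
      exact ⟨fixCount (cs.simple '' J) K, ((hf J).trans (by simp)).symm⟩
    | zero => exact (map_zero g).symm ▸ zero_mem _
    | one => exact (map_one g).symm ▸ one_mem _
    | add x y hx hy ihx ihy =>
      exact (map_add g ⟨x, hx⟩ ⟨y, hy⟩).symm ▸ add_mem ihx ihy
    | neg x hx ihx => exact (map_neg g ⟨x, hx⟩).symm ▸ neg_mem ihx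
    | mul x y hx hy ihx ihy =>
      exact (map_mul g ⟨x, hx⟩ ⟨y, hy⟩).symm ▸ mul_mem ihx ihy
  let e : ℤ ≃+* (Int.castRingHom ℚ).range := RingEquiv.ofBijective (Int.castRingHom ℚ).rangeRestrict
    ⟨fun a b h => Int.cast_injective (congrArg Subtype.val h),
      (Int.castRingHom ℚ).rangeRestrict_surjective⟩
  refine ⟨e.symm.toRingHom.comp (g.codRestrict _ hg), fun J => ?_⟩
  change e.symm (g.codRestrict _ hg (xIntegral cs J)) = _
  rw [RingEquiv.symm_apply_eq]
  refine Subtype.ext ?_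
  change f (xDescent cs J) = ((fixCount (cs.simple '' J) K : ℤ) : ℚ)
  rw [hf]; simp

theorem exists_modular_character {K : Set W} (hK : K ⊆ Set.range cs.simple) (p : ℕ) :
    ∃ f : DescentAlgebraMod cs p →+* ZMod p,
      ∀ J : Set B, f (xMod cs p J) = fixCount (cs.simple '' J) K := by
  obtain ⟨f, hf⟩ := exists_integral_character cs hK
  refine ⟨Ideal.Quotient.lift (pIdeal cs p) ((Int.castRingHom (ZMod p)).comp f) ?_, fun J => ?_⟩
  · intro a ha
    obtain ⟨c, rfl⟩ := Ideal.mem_span_singleton'.1 ha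
    simp
  · rw [xMod, Ideal.Quotient.lift_mk]
    simp [hf]

end Finite

end Descent

end

noncomputable section

namespace Descent

/-! ### Fixed points on coset spaces -/

theorem mk_mem_fixedPoints_iff {G : Type*} [Group G] {H P : Subgroup G} {w : G} :
    (w : G ⧸ P) ∈ MulAction.fixedPoints H (G ⧸ P) ↔ ∀ h ∈ H, w⁻¹ * h * w ∈ P := by
  have h1 : ∀ h : G, ((h * w : G) : G ⧸ P) = w ↔ w⁻¹ * h * w ∈ P := by
    intro h
    rw [eq_comm, QuotientGroup.eq, mul_assoc]
  exact ⟨fun h x hx => (h1 x).1 (h ⟨x, hx⟩), fun h x => (h1 x.1).2 (h x.1 x.2)⟩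

/-- The injection is wP ↦ (a w b)P'. It serves both for conjugating either argument of a mark and
for passing to parabolic closures. -/
theorem card_fixedPoints_le {G : Type*} [Group G] [Finite G] {H H' P P' : Subgroup G} (a b : G)
    (hP : ∀ x, x ∈ P ↔ b⁻¹ * x * b ∈ P')
    (h : ∀ w, (∀ x ∈ H, w⁻¹ * x * w ∈ P) → ∀ x ∈ H', (a * w * b)⁻¹ * x * (a * w * b) ∈ P') :
    Nat.card (MulAction.fixedPoints H (G ⧸ P)) ≤ Nat.card (MulAction.fixedPoints H' (G ⧸ P')) := by
  have hrel : ∀ v w : G, ((v : G ⧸ P) = w ↔ ((a * v * b : G) : G ⧸ P') = (a * w * b : G)) := by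
    intro v w
    rw [QuotientGroup.eq, QuotientGroup.eq, hP]
    simp [mul_assoc]
  refine Nat.card_le_card_of_injective
    (fun q => ⟨Quotient.liftOn' q.1 (fun w => ((a * w * b : G) : G ⧸ P')) ?_, ?_⟩) ?_
  · intro v w hvw
    exact (hrel v w).1 (Quotient.sound' hvw)
  · obtain ⟨q, hq⟩ := q
    obtain ⟨w, rfl⟩ := QuotientGroup.mk_surjective q
    exact mk_mem_fixedPoints_iff.2 (h w (mk_mem_fixedPoints_iff.1 hq))
  · rintro ⟨q, hq⟩ ⟨r, hr⟩ hqr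
    obtain ⟨v, rfl⟩ := QuotientGroup.mk_surjective q
    obtain ⟨w, rfl⟩ := QuotientGroup.mk_surjective r
    exact Subtype.ext ((hrel v w).2 (Subtype.mk.inj hqr))

theorem card_fixedPoints_self {G : Type*} [Group G] [Finite G] (H : Subgroup G) :
    Nat.card (MulAction.fixedPoints H (G ⧸ H)) =
      H.relIndex (Subgroup.normalizer (H : Set G)) :=
  Nat.card_congr (Sylow.fixedPointsMulLeftCosetsEquivQuotient H)

/-- The element n permutes the fixed points of H with p-th power trivial, so its orbits there have
size 1 or p. -/
theorem card_fixedPoints_modEq {G : Type*} [Group G] [Finite G] {H P : Subgroup G} {p : ℕ}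
    [Fact p.Prime] {n : G} (hn : n ∈ Subgroup.normalizer (H : Set G)) (hnp : n ^ p ∈ H) :
    Nat.card (MulAction.fixedPoints H (G ⧸ P)) ≡
      Nat.card (MulAction.fixedPoints (H ⊔ Subgroup.zpowers n : Subgroup G) (G ⧸ P)) [MOD p] := by
  classical
  have hmap : ∀ q ∈ MulAction.fixedPoints H (G ⧸ P), n • q ∈ MulAction.fixedPoints H (G ⧸ P) := by
    intro q hq x
    have h1 : n⁻¹ * x.1 * n ∈ H := by
      have := (Subgroup.mem_normalizer_iff.1 (inv_mem hn) x.1).1 x.2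
      simpa using this
    have h2 : (n⁻¹ * x.1 * n) • q = q := hq ⟨_, h1⟩
    change x.1 • n • q = n • q
    conv_rhs => rw [← h2]
    rw [smul_smul, smul_smul]
    congr 1; group
  let f : Function.End (MulAction.fixedPoints H (G ⧸ P)) := fun q => ⟨n • q.1, hmap q.1 q.2⟩
  have hfk : ∀ (k : ℕ) (q), ((f ^ k) q).1 = n ^ k • q.1 := by
    intro k q
    induction k with
    | zero => simp [Function.End.one_def]
    | succ k ih =>
      rw [pow_succ']
      change n • ((f ^ k) q).1 = _
      rw [ih, smul_smul, pow_succ']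
  have hf : f ^ p ^ 1 = 1 := by
    funext q
    refine Subtype.ext ?_
    rw [hfk, pow_one]
    exact q.2 ⟨_, hnp⟩
  have := Fintype.ofFinite (MulAction.fixedPoints H (G ⧸ P))
  have h := Equiv.Perm.card_fixedPoints_modEq hf
  rw [← Nat.card_eq_fintype_card, ← Nat.card_eq_fintype_card] at h
  refine h.trans (congrArg (· % p) ?_)
  refine Nat.card_eq_of_bijective (fun q => ⟨q.1.1, ?_⟩) ⟨?_, ?_⟩
  · have h1 : H ⊔ Subgroup.zpowers n ≤ MulAction.stabilizer G q.1.1 := by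
      refine sup_le (fun x hx => q.1.2 ⟨x, hx⟩) ?_
      rw [Subgroup.zpowers_le]
      exact congrArg Subtype.val q.2
    exact fun x => h1 x.2
  · intro q r hqr
    exact Subtype.ext (Subtype.ext (Subtype.mk.inj hqr))
  · rintro ⟨q, hq⟩
    refine ⟨⟨⟨q, fun x => hq ⟨x.1, Subgroup.mem_sup_left x.2⟩⟩, Subtype.ext ?_⟩, rfl⟩
    exact hq ⟨n, Subgroup.mem_sup_right (Subgroup.mem_zpowers n)⟩

/-- Cauchy's theorem in N(H)/H. -/
theorem exists_normalizer_pow_mem {G : Type*} [Group G] [Finite G] {H : Subgroup G} {p : ℕ}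
    [Fact p.Prime] (h : p ∣ H.relIndex (Subgroup.normalizer (H : Set G))) :
    ∃ n ∈ Subgroup.normalizer (H : Set G), n ^ p ∈ H ∧ n ∉ H := by
  obtain ⟨x, hx⟩ := exists_prime_orderOf_dvd_card'
    (G := Subgroup.normalizer (H : Set G) ⧸ H.subgroupOf (Subgroup.normalizer (H : Set G))) p h
  obtain ⟨n, rfl⟩ := QuotientGroup.mk_surjective x
  refine ⟨n, n.2, ?_, fun hn => ?_⟩
  · have := pow_orderOf_eq_one
      (n : Subgroup.normalizer (H : Set G) ⧸ H.subgroupOf (Subgroup.normalizer (H : Set G)))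
    rw [hx, ← QuotientGroup.mk_pow, QuotientGroup.eq_one_iff] at this
    exact this
  · have h1 : (n : Subgroup.normalizer (H : Set G) ⧸
        H.subgroupOf (Subgroup.normalizer (H : Set G))) = 1 :=
      (QuotientGroup.eq_one_iff n).2 hn
    rw [h1, orderOf_one] at hx
    exact (Fact.out : p.Prime).one_lt.ne hx

variable {B W : Type*} [Group W] {M : CoxeterMatrix B} (cs : CoxeterSystem M W)

/-! ### Parabolic closures -/

/-- The intersection of W_K with c W_J c⁻¹ is conjugate in W_K to a standard parabolic subgroup:
apply Kilmoyer's theorem to a shortest element of W_J c⁻¹ W_K. -/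
theorem exists_conj_closure_iff {J K : Set W} (hJ : J ⊆ Set.range cs.simple)
    (hK : K ⊆ Set.range cs.simple) (c : W) :
    ∃ v ∈ Subgroup.closure K, ∃ I ⊆ K, ∀ x ∈ Subgroup.closure K,
      v * x * v⁻¹ ∈ Subgroup.closure I ↔ c⁻¹ * x * c ∈ Subgroup.closure J := by
  classical
  have hne : ∃ n, ∃ u ∈ Subgroup.closure J, ∃ v ∈ Subgroup.closure K,
      cs.length (u * c⁻¹ * v) = n := ⟨_, 1, one_mem _, 1, one_mem _, rfl⟩
  obtain ⟨u, hu, v, hv, hn⟩ := Nat.find_spec hne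
  set d := u * c⁻¹ * v with hd
  have hD : d ∈ doubleReps cs J K := by
    constructor
    · intro x hx
      rw [cs.length_inv, ← cs.length_inv (d⁻¹ * x), mul_inv_rev, inv_inv, hn]
      refine Nat.find_min' hne ⟨x⁻¹ * u, mul_mem (inv_mem hx) hu, v, hv, ?_⟩
      rw [hd]; simp only [mul_assoc]
    · intro x hx
      rw [hn]
      refine Nat.find_min' hne ⟨u, hu, v * x, mul_mem hv hx, ?_⟩
      rw [hd]; simp only [mul_assoc]
  refine ⟨v⁻¹, inv_mem hv, conjInter J K d, conjInter_subset J K d, fun x hx => ?_⟩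
  rw [mem_closure_conjInter_iff cs hJ hK hD (mul_mem (mul_mem (inv_mem hv) hx)
    (inv_mem (inv_mem hv)))]
  have h1 : d * (v⁻¹ * x * v⁻¹⁻¹) * d⁻¹ = u * (c⁻¹ * x * c) * u⁻¹ := by rw [hd]; group
  rw [h1, Subgroup.mul_mem_cancel_right _ (inv_mem hu), Subgroup.mul_mem_cancel_left _ hu]

/-- Choose g W_L g⁻¹ of least order among the parabolic subgroups containing H. Its intersection
with another one is again parabolic, so minimality forces containment. -/
theorem exists_parabolicClosure [Finite W] (H : Subgroup W) :
    ∃ L ⊆ Set.range cs.simple, ∃ g : W, (∀ h ∈ H, g⁻¹ * h * g ∈ Subgroup.closure L) ∧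
      ∀ J ⊆ Set.range cs.simple, ∀ a : W, (∀ h ∈ H, a⁻¹ * h * a ∈ Subgroup.closure J) →
        ∀ x ∈ Subgroup.closure L, a⁻¹ * (g * x * g⁻¹) * a ∈ Subgroup.closure J := by
  classical
  have hne : ∃ n, ∃ L ⊆ Set.range cs.simple, ∃ g : W,
      (∀ h ∈ H, g⁻¹ * h * g ∈ Subgroup.closure L) ∧ Nat.card (Subgroup.closure L) = n :=
    ⟨_, Set.range cs.simple, subset_rfl, 1, fun h _ => by
      rw [cs.subgroup_closure_range_simple]; trivial, rfl⟩
  obtain ⟨L, hL, g, hg, hn⟩ := Nat.find_spec hne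
  refine ⟨L, hL, g, hg, fun J hJ a ha x hx => ?_⟩
  obtain ⟨v, hv, I, hI, hvI⟩ := exists_conj_closure_iff cs hJ hL (g⁻¹ * a)
  have h1 : ∀ h ∈ H, (g * v⁻¹)⁻¹ * h * (g * v⁻¹) ∈ Subgroup.closure I := by
    intro h hh
    have h2 := (hvI _ (hg h hh)).2 (by
      have := ha h hh
      simpa [mul_assoc] using this)
    simpa [mul_assoc] using h2
  have h3 := Nat.find_min' hne ⟨I, hI.trans hL, g * v⁻¹, h1, rfl⟩
  rw [← hn] at h3
  have h4 : Subgroup.closure I = Subgroup.closure L :=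
    Subgroup.eq_of_le_of_card_ge (Subgroup.closure_mono hI) h3
  have h5 := (hvI x hx).1 (by rw [h4]; exact mul_mem (mul_mem hv hx) (inv_mem hv))
  simpa [mul_assoc] using h5

/-! ### Conjugate subsets -/

theorem exists_conj_subset {J K : Set W} (hJ : J ⊆ Set.range cs.simple)
    (hK : K ⊆ Set.range cs.simple) (h : fixCount J K ≠ 0) :
    ∃ d : W, (fun x => d * x * d⁻¹) '' K ⊆ J := by
  rw [fixCount, card_fixedPoints_eq cs hJ hK] at h
  obtain ⟨⟨d, hd, hdK⟩⟩ := (Nat.card_ne_zero.1 h).1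
  refine ⟨d, ?_⟩
  rintro _ ⟨s, hs, rfl⟩
  have h1 := hs
  rw [← hdK] at h1
  obtain ⟨i, rfl⟩ := hK hs
  exact conj_mem_of_conj_mem_closure cs hJ hd.1 h1.2

theorem Conj.refl (J : Set B) : Conj cs J J := ⟨1, by simp⟩

theorem Conj.symm {J K : Set B} (h : Conj cs J K) : Conj cs K J := by
  obtain ⟨w, h⟩ := h
  refine ⟨w⁻¹, ?_⟩
  rw [← h, Set.image_image]
  simp [mul_assoc]

theorem Conj.exists_mem_parabolic_iff {J K : Set B} (h : Conj cs J K) :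
    ∃ w : W, ∀ x, x ∈ parabolic cs J ↔ w * x * w⁻¹ ∈ parabolic cs K := by
  obtain ⟨w, h⟩ := h
  refine ⟨w, fun x => ?_⟩
  have : parabolic cs K = (parabolic cs J).map (MulAut.conj w).toMonoidHom := by
    rw [parabolic, parabolic, MonoidHom.map_closure, ← h]
    rfl
  rw [this, Subgroup.mem_map_iff_mem (f := (MulAut.conj w).toMonoidHom)
    (MulAut.conj w).injective (x := x) |>.symm]
  rfl

theorem IsRepresentatives.eq_of_conj {E : Set (Set B)} (hE : IsRepresentatives cs E)
    {K L : Set B} (hK : K ∈ E) (hL : L ∈ E) (h : Conj cs K L) : K = L :=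
  (hE K).unique ⟨hK, Conj.refl cs K⟩ ⟨hL, h⟩

theorem tableOfMarksMod_apply (E : Set (Set B)) (p : ℕ) (J K : E) :
    tableOfMarksMod cs E p J K = (mark cs J K : ZMod p) := by
  simp [tableOfMarksMod, tableOfMarks]

/-! ### Congruences between marks and invariance under conjugation. -/

section Finite

variable [Finite W]

/-- W_L is a conjugate of the parabolic closure of ⟨W_K, n⟩. A subgroup and its parabolic closure
fix the same points of W/W_J, since point stabilizers there are parabolic. -/
theorem exists_card_lt_of_dvd {p : ℕ} [Fact p.Prime] {K : Set W}
    (h : p ∣ fixCount K K) :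
    ∃ L ⊆ Set.range cs.simple, Nat.card (Subgroup.closure K) < Nat.card (Subgroup.closure L) ∧
      ∀ J ⊆ Set.range cs.simple, fixCount J K ≡ fixCount J L [MOD p] := by
  rw [fixCount, card_fixedPoints_self] at h
  obtain ⟨n, hn, hnp, hnK⟩ := exists_normalizer_pow_mem h
  obtain ⟨L, hL, g, hg, hmin⟩ := exists_parabolicClosure cs
    (Subgroup.closure K ⊔ Subgroup.zpowers n)
  refine ⟨L, hL, ?_, fun J hJ => ?_⟩
  · have hlt : Subgroup.closure K < Subgroup.closure K ⊔ Subgroup.zpowers n :=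
      lt_of_le_of_ne le_sup_left fun h' =>
        hnK (h' ▸ Subgroup.mem_sup_right (Subgroup.mem_zpowers n))
    refine lt_of_lt_of_le (Set.ncard_lt_ncard hlt (Set.toFinite _)) ?_
    exact Nat.card_le_card_of_injective
      (fun x => (⟨g⁻¹ * x.1 * g, hg x.1 x.2⟩ : Subgroup.closure L))
      fun x y hxy => Subtype.ext (by simpa using Subtype.mk.inj hxy)
  · refine (card_fixedPoints_modEq hn hnp).trans (congrArg (· % p) (le_antisymm ?_ ?_))
    · refine card_fixedPoints_le g⁻¹ 1 (by simp) fun w hw x hx => ?_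
      have := hmin J hJ w hw x hx
      simpa [mul_assoc] using this
    · refine card_fixedPoints_le g 1 (by simp) fun w hw x hx => ?_
      have := hw _ (hg x hx)
      simpa [mul_assoc] using this

theorem exists_not_dvd {p : ℕ} [Fact p.Prime] {K : Set W} (hK : K ⊆ Set.range cs.simple) :
    ∃ L ⊆ Set.range cs.simple, ¬ p ∣ fixCount L L ∧
      ∀ J ⊆ Set.range cs.simple, fixCount J K ≡ fixCount J L [MOD p] := by
  induction hn : Nat.card W - Nat.card (Subgroup.closure K) using Nat.strong_induction_on
    generalizing K with
  | _ n ih =>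
  by_cases h : p ∣ fixCount K K
  · obtain ⟨L, hL, hlt, hcong⟩ := exists_card_lt_of_dvd cs h
    have hle : Nat.card (Subgroup.closure L) ≤ Nat.card W := Subgroup.card_le_card_group _
    obtain ⟨L', hL', h1, h2⟩ := ih _ (by omega) hL rfl
    exact ⟨L', hL', h1, fun J hJ => (hcong J hJ).trans (h2 J hJ)⟩
  · exact ⟨K, hK, h, fun J _ => Nat.ModEq.refl _⟩

theorem fixCount_self_pos (K : Set W) : 0 < fixCount K K := by
  rw [fixCount, card_fixedPoints_self]
  exact Nat.pos_of_ne_zero Subgroup.index_ne_zero_of_finite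

theorem conj_of_mark_ne_zero {J K : Set B} (h : mark cs J K ≠ 0) (h' : mark cs K J ≠ 0) :
    Conj cs K J := by
  obtain ⟨d, hd⟩ := exists_conj_subset cs (Set.image_subset_range _ _)
    (Set.image_subset_range _ _) h
  obtain ⟨e, he⟩ := exists_conj_subset cs (Set.image_subset_range _ _)
    (Set.image_subset_range _ _) h'
  refine ⟨d, Set.eq_of_subset_of_ncard_le hd ?_⟩
  have h1 := Set.ncard_le_ncard he
  have hinj : ∀ d : W, Function.Injective fun x => d * x * d⁻¹ := fun d x y h => by simpa using h
  rw [Set.ncard_image_of_injective _ (hinj _)] at h1 ⊢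
  exact h1

theorem mark_le_of_conj_left {J J' : Set B} (h : Conj cs J J') (K : Set B) :
    mark cs J K ≤ mark cs J' K := by
  obtain ⟨w, hw⟩ := h.exists_mem_parabolic_iff
  refine card_fixedPoints_le 1 w⁻¹ (by simpa using hw) fun v hv x hx => ?_
  have := (hw _).1 (hv x hx)
  simpa [mul_assoc] using this

theorem mark_eq_of_conj_left {J J' : Set B} (h : Conj cs J J') (K : Set B) :
    mark cs J K = mark cs J' K :=
  le_antisymm (mark_le_of_conj_left cs h K) (mark_le_of_conj_left cs h.symm K)

theorem mark_le_of_conj_right {K K' : Set B} (h : Conj cs K K') (J : Set B) :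
    mark cs J K ≤ mark cs J K' := by
  obtain ⟨w, hw⟩ := h.exists_mem_parabolic_iff
  refine card_fixedPoints_le w 1 (by simp) fun v hv x hx => ?_
  have := hv _ ((hw (w⁻¹ * x * w)).2 (by simpa [mul_assoc] using hx))
  simpa [mul_assoc] using this

theorem mark_eq_of_conj_right {K K' : Set B} (h : Conj cs K K') (J : Set B) :
    mark cs J K = mark cs J K' :=
  le_antisymm (mark_le_of_conj_right cs h J) (mark_le_of_conj_right cs h.symm J)

theorem mark_self (J : Set B) : mark cs J J = normalizerIndex cs J :=
  card_fixedPoints_self _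

/-! ### The number of columns modulo a prime -/

/-- Every column equals one with diagonal entry prime to p. If two such columns K and L agree, then
β_{KL} and β_{LK} are nonzero, so K and L are conjugate. -/
theorem ncard_range_col {E : Set (Set B)} (hE : IsRepresentatives cs E) (p : ℕ) [Fact p.Prime] :
    (Set.range (tableOfMarksMod cs E p).col).ncard =
      {J ∈ E | ¬ p ∣ normalizerIndex cs J}.ncard := by
  have himage : Set.range (tableOfMarksMod cs E p).col =
      (tableOfMarksMod cs E p).col '' {K : E | ¬ p ∣ normalizerIndex cs K} := by
    refine Set.Subset.antisymm ?_ (Set.image_subset_range _ _)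
    rintro _ ⟨K, rfl⟩
    obtain ⟨L, hL, hLp, hcong⟩ := exists_not_dvd cs (p := p)
      (Set.image_subset_range cs.simple K.1)
    rw [← Set.image_preimage_eq_of_subset hL] at hLp hcong
    obtain ⟨L', ⟨hL'E, hconj⟩, -⟩ := hE (cs.simple ⁻¹' L)
    refine ⟨⟨L', hL'E⟩, ?_, ?_⟩
    · rw [← mark_eq, mark_eq_of_conj_left cs hconj, mark_eq_of_conj_right cs hconj,
        mark_self] at hLp
      exact hLp
    · funext J
      simp only [Matrix.col_apply, tableOfMarksMod_apply, ZMod.natCast_eq_natCast_iff]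
      rw [← mark_eq_of_conj_right cs hconj]
      exact (hcong _ (Set.image_subset_range _ _)).symm
  have hinj : Set.InjOn (tableOfMarksMod cs E p).col {K : E | ¬ p ∣ normalizerIndex cs K} := by
    intro K hK L hL h
    have key : ∀ J : E, (mark cs J K : ZMod p) = mark cs J L := by
      intro J
      simpa only [Matrix.col_apply, tableOfMarksMod_apply] using congrFun h J
    have hne : ∀ K : E, ¬ p ∣ normalizerIndex cs K → (mark cs K K : ZMod p) ≠ 0 := by
      intro K hK h0
      rw [mark_self, ZMod.natCast_eq_zero_iff] at h0
      exact hK h0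
    have h1 : mark cs K L ≠ 0 := fun h0 => hne K hK (by rw [key, h0, Nat.cast_zero])
    have h2 : mark cs L K ≠ 0 := fun h0 => hne L hL (by rw [← key, h0, Nat.cast_zero])
    exact Subtype.ext (hE.eq_of_conj cs K.2 L.2 (conj_of_mark_ne_zero cs h2 h1))
  rw [himage, hinj.ncard_image, ← Set.ncard_image_of_injective _ Subtype.val_injective]
  congr 1
  ext K
  simp [and_comm]

end Finite

end Descent

end

/-! ### Irreducible representations of the two algebras. -/

noncomputable section

namespace Descent

variable {B W : Type*} [Group W] {M : CoxeterMatrix B} (cs : CoxeterSystem M W) [Finite W]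

theorem repSum_mem_descentAlgebra (L : SimpleSubset cs) : repSum cs L.1 ∈ descentAlgebra cs :=
  repSum_eq_xElt cs L.2 ▸ (xDescent cs (cs.simple ⁻¹' L.1)).2

theorem repSum_mem_integralForm (L : SimpleSubset cs) : repSum cs L.1 ∈ integralForm cs :=
  repSum_eq_xElt cs L.2 ▸ (xIntegral cs (cs.simple ⁻¹' L.1)).2

theorem descentAlgebra_subring_eq_top {T : Subring (descentAlgebra cs)}
    (h : ∀ J, xDescent cs J ∈ T) (hT : Set.range (algebraMap ℚ (descentAlgebra cs)) ⊆ T) :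
    T = ⊤ := by
  rw [eq_top_iff]
  rintro ⟨a, ha⟩ -
  induction ha using Algebra.adjoin_induction with
  | mem a ha =>
    obtain ⟨J, rfl⟩ := ha
    exact h J
  | algebraMap r => exact hT ⟨r, rfl⟩
  | add x y _ _ hx hy => exact T.add_mem hx hy
  | mul x y hx' hy' hx hy =>
    exact (MulMemClass.mk_mul_mk (descentAlgebra cs) x y hx' hy') ▸ T.mul_mem hx hy

theorem descentAlgebraMod_subring_eq_top {p : ℕ} {T : Subring (DescentAlgebraMod cs p)}
    (h : ∀ J, xMod cs p J ∈ T) : T = ⊤ := by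
  rw [eq_top_iff]
  rintro a -
  obtain ⟨⟨a, ha⟩, rfl⟩ := Ideal.Quotient.mk_surjective a
  induction ha using Subring.closure_induction with
  | mem a ha =>
    obtain ⟨J, rfl⟩ := ha
    exact h J
  | zero => exact zero_mem T
  | one => exact one_mem T
  | add x y _ _ hx hy => exact T.add_mem hx hy
  | neg x _ hx => exact neg_mem hx
  | mul x y _ _ hx hy => exact T.mul_mem hx hy

theorem descentAlgebra_ringHom_ext {f g : descentAlgebra cs →+* ℚ}
    (h : ∀ J, f (xDescent cs J) = g (xDescent cs J)) : f = g := by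
  have : f.eqLocus g = ⊤ := by
    refine descentAlgebra_subring_eq_top cs h ?_
    rintro _ ⟨q, rfl⟩
    exact RingHom.congr_fun (Subsingleton.elim (f.comp (algebraMap ℚ _))
      (g.comp (algebraMap ℚ _))) q
  exact RingHom.ext fun a => (this ▸ Subring.mem_top a : a ∈ f.eqLocus g)

theorem descentAlgebraMod_ringHom_ext {p : ℕ} {R : Type*} [Ring R]
    {f g : DescentAlgebraMod cs p →+* R}
    (h : ∀ J, f (xMod cs p J) = g (xMod cs p J)) : f = g := by
  have : f.eqLocus g = ⊤ := descentAlgebraMod_subring_eq_top cs h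
  exact RingHom.ext fun a => (this ▸ Subring.mem_top a : a ∈ f.eqLocus g)

theorem exists_isGivenByCharacter {k V : Type*} [Field k] [Algebra ℚ k] [AddCommGroup V]
    [Module k V] {ρ : descentAlgebra cs →+* Module.End k V} (hρ : IsIrreducibleRep ρ) :
    ∃ (f : descentAlgebra cs →+* ℚ) (L : Set B),
      (∀ J, f (xDescent cs J) = mark cs J L) ∧ IsGivenByCharacter ρ f := by
  choose f hf using fun L : SimpleSubset cs => exists_character cs L.2
  obtain ⟨L, hL⟩ : ∃ L, IsGivenByCharacter ρ (f L) := by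
    refine hρ.exists_isGivenByCharacter
      (fun L : SimpleSubset cs => ⟨repSum cs L.1, repSum_mem_descentAlgebra cs L⟩) f
      (fun J K => fixCount J.1 K.1) (Set.range (algebraMap ℚ (descentAlgebra cs))) ?_ ?_ ?_ ?_ ?_
    · refine fun T h => descentAlgebra_subring_eq_top cs fun J => h ?_
      exact ⟨⟨_, Set.image_subset_range cs.simple J⟩, rfl⟩
    · rintro _ ⟨q, rfl⟩ K v
      -- Ring homomorphisms out of ℚ are unique, so ρ is automatically ℚ-linear.
      have h1 : ρ (algebraMap ℚ _ q) = algebraMap k (Module.End k V) (algebraMap ℚ k q) :=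
        RingHom.congr_fun (Subsingleton.elim (ρ.comp (algebraMap ℚ _))
          ((algebraMap k (Module.End k V)).comp (algebraMap ℚ k))) q
      have h2 : f K (algebraMap ℚ _ q) = q :=
        RingHom.congr_fun (Subsingleton.elim ((f K).comp (algebraMap ℚ _)) (RingHom.id ℚ)) q
      rw [h1, h2, Module.algebraMap_end_apply]
    · exact ⟨⟨_, subset_rfl⟩, Subtype.ext (repSum_range cs)⟩
    · intro J K
      have := hf K (cs.simple ⁻¹' J.1)
      rw [Set.image_preimage_eq_of_subset J.2] at this
      rw [← this]
      exact congrArg (f K) (Subtype.ext (repSum_eq_xElt cs J.2))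
    · exact mul_eq_natCast_mul_add cs _ (repSum_mem_descentAlgebra cs)
  refine ⟨f L, cs.simple ⁻¹' L.1, fun J => ?_, hL⟩
  rw [hf, mark_eq, Set.image_preimage_eq_of_subset L.2]

theorem exists_isGivenByCharacter_mod {p : ℕ} [Fact p.Prime] {k V : Type*} [Field k]
    [Algebra (ZMod p) k] [AddCommGroup V] [Module k V]
    {ρ : DescentAlgebraMod cs p →+* Module.End k V} (hρ : IsIrreducibleRep ρ) :
    ∃ (f : DescentAlgebraMod cs p →+* ZMod p) (L : Set B),
      (∀ J, f (xMod cs p J) = mark cs J L) ∧ IsGivenByCharacter ρ f := by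
  choose f hf using fun L : SimpleSubset cs => exists_modular_character cs L.2 p
  obtain ⟨L, hL⟩ : ∃ L, IsGivenByCharacter ρ (f L) := by
    refine hρ.exists_isGivenByCharacter
      (fun L : SimpleSubset cs =>
      Ideal.Quotient.mk (pIdeal cs p) ⟨repSum cs L.1, repSum_mem_integralForm cs L⟩) f
      (fun J K => fixCount J.1 K.1) ∅ ?_ (by simp) ?_ ?_ ?_
    · refine fun T h _ => descentAlgebraMod_subring_eq_top cs fun J => h ?_
      exact ⟨⟨_, Set.image_subset_range cs.simple J⟩, rfl⟩
    · exact ⟨⟨_, subset_rfl⟩, congrArg (Ideal.Quotient.mk (pIdeal cs p))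
        (Subtype.ext (repSum_range cs) : (_ : integralForm cs) = 1)⟩
    · intro J K
      have := hf K (cs.simple ⁻¹' J.1)
      rw [Set.image_preimage_eq_of_subset J.2] at this
      rw [← this]
      exact congrArg (fun a => f K (Ideal.Quotient.mk (pIdeal cs p) a))
        (Subtype.ext (repSum_eq_xElt cs J.2))
    · intro J K
      obtain ⟨y, hy, h⟩ := mul_eq_natCast_mul_add cs _ (repSum_mem_integralForm cs) J K
      refine ⟨Ideal.Quotient.mk (pIdeal cs p) y, ?_, ?_⟩
      · have := AddSubgroup.mem_map_of_mem (Ideal.Quotient.mk (pIdeal cs p)).toAddMonoidHom hy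
        rw [AddMonoidHom.map_closure, Set.image_image] at this
        exact this
      · rw [← map_mul, h, map_add, map_mul, map_natCast]
  refine ⟨f L, cs.simple ⁻¹' L.1, fun J => ?_, hL⟩
  rw [hf, mark_eq, Set.image_preimage_eq_of_subset L.2]

end Descent

end

theorem lemma4p1 {B W : Type*} [Finite B] [Group W] [Finite W] {M : CoxeterMatrix B}
    (cs : CoxeterSystem M W) (E : Set (Set B)) (hE : Descent.IsRepresentatives cs E)
    (p : ℕ) [Fact p.Prime] :
    (∃ lam : E → (Descent.descentAlgebra cs →+* ℚ),
      (∀ (K J : E) (J' : Set B), Descent.Conj cs J J' →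
        lam K (Descent.xDescent cs J') = (Descent.tableOfMarks cs E J K : ℚ)) ∧
      Function.Injective lam ∧
      ∀ (k V : Type*) [Field k] [Algebra ℚ k] [AddCommGroup V] [Module k V]
        (ρ : Descent.descentAlgebra cs →+* Module.End k V),
        IsIrreducibleRep ρ ↔ ∃ K : E, IsGivenByCharacter ρ (lam K)) ∧
    (∃ mu : E → (Descent.DescentAlgebraMod cs p →+* ZMod p),
      (∀ (K J : E) (J' : Set B), Descent.Conj cs J J' →
        mu K (Descent.xMod cs p J') = Descent.tableOfMarksMod cs E p J K) ∧
      (∀ K L : E, mu K = mu L ↔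
        (Descent.tableOfMarksMod cs E p).col K = (Descent.tableOfMarksMod cs E p).col L) ∧
      ∀ (k V : Type*) [Field k] [Algebra (ZMod p) k] [AddCommGroup V] [Module k V]
        (ρ : Descent.DescentAlgebraMod cs p →+* Module.End k V),
        IsIrreducibleRep ρ ↔ ∃ K : E, IsGivenByCharacter ρ (mu K)) ∧
    (Set.range (Descent.tableOfMarksMod cs E p).col).ncard =
      {J ∈ E | ¬ p ∣ Descent.normalizerIndex cs J}.ncard := by
  refine ⟨?_, ?_, Descent.ncard_range_col cs hE p⟩
  · choose lam hlam using fun K : E =>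
      Descent.exists_character cs (Set.image_subset_range cs.simple K.1)
    replace hlam : ∀ (K : E) J, lam K (Descent.xDescent cs J) = Descent.mark cs J K := hlam
    refine ⟨lam, fun K J J' h => ?_, fun K L h => ?_, fun k V _ _ _ _ ρ => ⟨fun hρ => ?_, ?_⟩⟩
    · rw [hlam, ← Descent.mark_eq_of_conj_left cs h]
      simp [Descent.tableOfMarks]
    · have key : ∀ J, Descent.mark cs J K = Descent.mark cs J L := fun J => by
        have := hlam K J
        rw [h, hlam] at this
        exact_mod_cast this.symm
      have hpos : ∀ J, Descent.mark cs J J ≠ 0 := fun J => (Descent.fixCount_self_pos _).ne'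
      exact Subtype.ext (hE.eq_of_conj cs K.2 L.2 (Descent.conj_of_mark_ne_zero cs
        (key L ▸ hpos L) (key K ▸ hpos K)))
    · obtain ⟨f, L, hf, hρf⟩ := Descent.exists_isGivenByCharacter cs hρ
      -- The character found belongs to an arbitrary L ⊆ S; marks depend only on its conjugacy
      -- class, so L may be replaced by its representative in E.
      obtain ⟨K, ⟨hK, hconj⟩, -⟩ := hE L
      refine ⟨⟨K, hK⟩, ?_⟩
      rwa [← Descent.descentAlgebra_ringHom_ext cs (f := f) (g := lam ⟨K, hK⟩) fun J => by
        rw [hf, hlam, Descent.mark_eq_of_conj_right cs hconj]]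
    · rintro ⟨K, h⟩
      exact h.isIrreducibleRep
  · choose mu hmu using fun K : E =>
      Descent.exists_modular_character cs (Set.image_subset_range cs.simple K.1) p
    replace hmu : ∀ (K : E) J, mu K (Descent.xMod cs p J) = Descent.mark cs J K := hmu
    refine ⟨mu, fun K J J' h => ?_, fun K L => ⟨fun h => ?_, fun h => ?_⟩,
      fun k V _ _ _ _ ρ => ⟨fun hρ => ?_, ?_⟩⟩
    · rw [hmu, ← Descent.mark_eq_of_conj_left cs h, Descent.tableOfMarksMod_apply]
    · funext J
      rw [Matrix.col_apply, Matrix.col_apply, Descent.tableOfMarksMod_apply,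
        Descent.tableOfMarksMod_apply, ← hmu, ← hmu, h]
    · refine Descent.descentAlgebraMod_ringHom_ext cs fun J => ?_
      obtain ⟨J', ⟨hJ', hconj⟩, -⟩ := hE J
      have := congrFun h ⟨J', hJ'⟩
      rw [Matrix.col_apply, Matrix.col_apply, Descent.tableOfMarksMod_apply,
        Descent.tableOfMarksMod_apply] at this
      rw [hmu, hmu, Descent.mark_eq_of_conj_left cs hconj, Descent.mark_eq_of_conj_left cs hconj,
        this]
    · obtain ⟨f, L, hf, hρf⟩ := Descent.exists_isGivenByCharacter_mod cs hρ
      obtain ⟨K, ⟨hK, hconj⟩, -⟩ := hE L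
      refine ⟨⟨K, hK⟩, ?_⟩
      rwa [← Descent.descentAlgebraMod_ringHom_ext cs (f := f) (g := mu ⟨K, hK⟩) fun J => by
        rw [hf, hmu, Descent.mark_eq_of_conj_right cs hconj]]
    · rintro ⟨K, h⟩
      exact h.isIrreducibleRep
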